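/- Let $F$ be an infinite field (of arbitrary characteristic), let $G$ be a group with identity $e$, let $n\ge 1$, and let $g_1,\dots,g_n\in G$ be pairwise distinct. A $(G,*)$-algebra is a $G$-graded associative unital $F$-algebra $A=\bigoplus_{g\in G}A_g$ with an $F$-linear involution $*$ such that $(A_g)^*=A_{g^{-1}}$ for all $g\in G$. A homomorphism of such algebras is a unital algebra homomorphism $\varphi$ with $\varphi(A_g)\subseteq B_g$ and $\varphi(a^*)=\varphi(a)^*$. The matrix algebra $M_n(F)$ is regarded as a $(G,*)$-algebra with the elementary grading defined by $(g_1,\dots,g_n)$, that is, $M_n(F)_g=\operatorname{span}_F\{e_{ij} : g_i^{-1}g_j=g\}$, and with the transpose as involution. Its support is $\{g\in G : M_n(F)_g\neq 0\}$. Let $F\langle X\mid(G,*)\rangle$ be the free unital associative algebra freely generated by the variables $x_{k,g}$ and $x_{k,g}^*$ ($k\in\mathbb N$, $g\in G$), with the involution that reverses products and exchanges $x_{k,g}$ and $x_{k,g}^*$, and with the $G$-grading in which $\deg x_{k,g}=g$, $\deg x_{k,g}^*=g^{-1}$, and the degree of a monomial is the product of the degrees of its letters. A $(G,*)$-identity of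 a $(G,*)$-algebra $A$ is an element $f\in F\langle X\mid(G,*)\rangle$ with $\varphi(f)=0$ for every homomorphism of graded algebras with involution $\varphi:F\langle X\mid(G,*)\rangle\to A$; the set of all of them is denoted $T_G^*(A)$. A $T_G^*$-ideal is a two-sided ideal of $F\langle X\mid(G,*)\rangle$ closed under all endomorphisms of $F\langle X\mid(G,*)\rangle$ as a graded algebra with involution; the $T_G^*$-ideal generated by a set is the intersection of all $T_G^*$-ideals containing it. Then $T_G^*(M_n(F))=U$, where $U$ is the $T_G^*$-ideal generated by the following elements: 1. $x_{1,e}x_{2,e}-x_{2,e}x_{1,e}$; 2. $x_{1,e}-x_{1,e}^*$; 3. $x_{1,g}$ for every $g\in G$ outside the support of $M_n(F)$; 4. all monomials in the variables $x_{k,g},x_{k,g}^*$ of length at most $2n-1$ that are $(G,*)$-identities of $M_n(F)$. -/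

import Mathlib

universe u v w w'

/-- A `(G, *)`-algebra structure on the associative unital `F`-algebra `A`: a `G`-grading
`A = ⨁ g, A_g` together with a degree-inverting involution, `(A_g)^* = A_{g⁻¹}`. -/
structure GStarAlgebra (F : Type u) (G : Type v) (A : Type w)
    [Field F] [Group G] [Ring A] [Algebra F A] where
  /-- The homogeneous component `A_g`. -/
  component : G → Submodule F A
  /-- The sum of the components is direct. -/
  indep : iSupIndep component
  /-- The components span `A`. -/
  iSup_eq_top : ⨆ g, component g = ⊤
  /-- `A_g A_h ⊆ A_{gh}`. -/
  mul_mem : ∀ {g h : G} {a b : A}, a ∈ component g → b ∈ component h → a * b ∈ component (g * h)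
  /-- The involution `a ↦ a^*`. -/
  invol : A →ₗ[F] A
  invol_mul : ∀ a b : A, invol (a * b) = invol b * invol a
  invol_invol : ∀ a : A, invol (invol a) = a
  /-- `(A_g)^* = A_{g⁻¹}`. -/
  map_invol : ∀ g : G, (component g).map invol = component g⁻¹

namespace GStarAlgebra

variable {F : Type u} {G : Type v} {A : Type w} {B : Type w'}
  [Field F] [Ring A] [Algebra F A] [Ring B] [Algebra F B]

/-- The support `{g | A_g ≠ 0}` of the grading. -/
def support [Group G] (S : GStarAlgebra F G A) : Set G := {g | S.component g ≠ ⊥}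

/-- Homomorphisms of graded algebras with involution. -/
structure IsHom [Group G] (S : GStarAlgebra F G A) (T : GStarAlgebra F G B) (φ : A →ₐ[F] B) : Prop where
  map_component : ∀ (g : G) (a : A), a ∈ S.component g → φ a ∈ T.component g
  map_invol : ∀ a : A, φ (S.invol a) = T.invol (φ a)

/-- For a basis `b` whose members are assigned degrees, the spans of the members of equal degree
are independent. -/
theorem indep_of_basis {ι : Type*} (b : Module.Basis ι F A) (d : ι → G) :
    iSupIndep fun g => Submodule.span F (b '' {i | d i = g}) := by
  intro g
  have h : (⨆ (h : G) (_ : h ≠ g), Submodule.span F (b '' {i | d i = h}))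
      ≤ Submodule.span F (b '' {i | d i ≠ g}) := by
    refine iSup₂_le fun h hh => Submodule.span_mono (Set.image_mono ?_)
    intro i (hi : d i = h)
    exact fun h' => hh (hi.symm.trans h')
  refine (b.linearIndependent.disjoint_span_image ?_).mono_right h
  rw [Set.disjoint_left]
  exact fun i hi hi' => hi' hi

/-- For a basis `b` whose members are assigned degrees, the spans of the members of equal degree
span everything. -/
theorem iSup_of_basis {ι : Type*} (b : Module.Basis ι F A) (d : ι → G) :
    ⨆ g, Submodule.span F (b '' {i | d i = g}) = ⊤ := by
  rw [eq_top_iff, ← b.span_eq, Submodule.span_le]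
  rintro _ ⟨i, rfl⟩
  exact Submodule.mem_iSup_of_mem (d i) (Submodule.subset_span ⟨i, rfl, rfl⟩)

/-- A criterion for `(A_g)^* = A_{g⁻¹}`. -/
theorem map_eq_of_forall_mem [Group G] (c : G → Submodule F A) (s : A →ₗ[F] A) (hs : ∀ a, s (s a) = a)
    (h : ∀ g, ∀ a ∈ c g, s a ∈ c g⁻¹) (g : G) : (c g).map s = c g⁻¹ := by
  apply le_antisymm
  · rintro _ ⟨a, ha, rfl⟩
    exact h g a ha
  · intro a ha
    exact ⟨s a, by simpa using h g⁻¹ a ha, hs a⟩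

end GStarAlgebra

/-- The free generators: `Letter.x k g` is `x_{k,g}` and `Letter.xs k g` is `x_{k,g}^*`. -/
inductive Letter (G : Type v) : Type v
  | x (k : ℕ) (g : G)
  | xs (k : ℕ) (g : G)

namespace Letter

variable {G : Type v}

/-- The degrees: `deg x_{k,g} = g` and `deg x_{k,g}^* = g⁻¹`. -/
def deg [Group G] : Letter G → G
  | x _ g => g
  | xs _ g => g⁻¹

/-- The involution `x_{k,g} ↔ x_{k,g}^*` on the generators. -/
def swap : Letter G → Letter G
  | x k g => xs k g
  | xs k g => x k g

theorem swap_swap (l : Letter G) : l.swap.swap = l := by cases l <;> rfl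

theorem deg_swap [Group G] (l : Letter G) : l.swap.deg = l.deg⁻¹ := by
  cases l <;> simp [swap, deg]

end Letter

namespace FreeGStar

variable (F : Type u) (G : Type v) [Field F]

variable {G} in
/-- The monomial (product of generators) given by a word; the empty word gives `1`. -/
noncomputable def monomial (w : List (Letter G)) : FreeAlgebra F (Letter G) :=
  (w.map (FreeAlgebra.ι F)).prod

variable {G} in
/-- The degree in `G` of a word: the product of the degrees of its letters. -/
def wordDeg [Group G] (w : List (Letter G)) : G := (w.map Letter.deg).prod

/-- The component of degree `g` of the free algebra: the span of the monomials of degree `g`. -/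
noncomputable def component [Group G] (g : G) : Submodule F (FreeAlgebra F (Letter G)) :=
  Submodule.span F (monomial F '' {w | wordDeg w = g})

/-- The involution of the free algebra, as an algebra map to the opposite algebra. -/
noncomputable def involOp : FreeAlgebra F (Letter G) →ₐ[F] (FreeAlgebra F (Letter G))ᵐᵒᵖ :=
  FreeAlgebra.lift F fun l => MulOpposite.op (FreeAlgebra.ι F l.swap)

/-- The involution of the free algebra: the antiautomorphism that exchanges `x_{k,g}` and
`x_{k,g}^*`. -/
noncomputable def invol : FreeAlgebra F (Letter G) →ₗ[F] FreeAlgebra F (Letter G) :=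
  (MulOpposite.opLinearEquiv F).symm.toLinearMap ∘ₗ (involOp F G).toLinearMap

theorem invol_mul (a b : FreeAlgebra F (Letter G)) :
    invol F G (a * b) = invol F G b * invol F G a := by
  simp [invol]

theorem invol_ι (l : Letter G) :
    invol F G (FreeAlgebra.ι F l) = FreeAlgebra.ι F l.swap := by
  simp [invol, involOp]

theorem invol_algebraMap (r : F) : invol F G (algebraMap F _ r) = algebraMap F _ r := by
  simp [invol]

theorem invol_invol (a : FreeAlgebra F (Letter G)) : invol F G (invol F G a) = a := by
  induction a using FreeAlgebra.induction with
  | grade0 r => simp only [invol_algebraMap]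
  | grade1 l => simp only [invol_ι, Letter.swap_swap]
  | mul a b ha hb => simp only [invol_mul, ha, hb]
  | add a b ha hb => simp only [map_add, ha, hb]

theorem invol_monomial (w : List (Letter G)) :
    invol F G (monomial F w) = monomial F (w.map Letter.swap).reverse := by
  induction w with
  | nil => simpa [monomial] using invol_algebraMap F G 1
  | cons l w ih =>
    simp only [monomial, List.map_cons, List.prod_cons, invol_mul, invol_ι, List.reverse_cons,
      List.map_append, List.prod_append, List.map_nil, List.prod_nil, mul_one] at ih ⊢
    rw [ih]

theorem wordDeg_reverse [Group G] (w : List (Letter G)) :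
    wordDeg (w.map Letter.swap).reverse = (wordDeg w)⁻¹ := by
  induction w with
  | nil => simp [wordDeg]
  | cons l w ih =>
    simp only [wordDeg, List.map_cons, List.prod_cons, List.reverse_cons,
      List.map_append, List.prod_append, List.map_nil, List.prod_nil, mul_one, mul_inv_rev,
      Letter.deg_swap] at ih ⊢
    rw [ih]

theorem basis_apply (w : List (Letter G)) :
    FreeAlgebra.basisFreeMonoid F (Letter G) (FreeMonoid.ofList w) = monomial F w := by
  simp [FreeAlgebra.basisFreeMonoid, monomial, FreeAlgebra.equivMonoidAlgebraFreeMonoid,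
    FreeMonoid.lift_apply]

theorem component_eq [Group G] (g : G) : component F G g = Submodule.span F
    (FreeAlgebra.basisFreeMonoid F (Letter G) '' {w | wordDeg (FreeMonoid.toList w) = g}) := by
  unfold component
  congr 1
  ext a
  constructor
  · rintro ⟨w, hw, rfl⟩
    exact ⟨FreeMonoid.ofList w, hw, basis_apply F G w⟩
  · rintro ⟨w, hw, rfl⟩
    exact ⟨FreeMonoid.toList w, hw, (basis_apply F G (FreeMonoid.toList w)).symm⟩

/-- The free `(G, *)`-algebra `F⟨X | (G, *)⟩`. -/
noncomputable def algebra [Group G] : GStarAlgebra F G (FreeAlgebra F (Letter G)) where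
  component := component F G
  indep := by
    rw [funext (component_eq F G)]
    exact GStarAlgebra.indep_of_basis _ fun w => wordDeg (FreeMonoid.toList w)
  iSup_eq_top := by
    rw [iSup_congr (component_eq F G)]
    exact GStarAlgebra.iSup_of_basis _ fun w => wordDeg (FreeMonoid.toList w)
  mul_mem := by
    intro g h a b ha hb
    have hab := Submodule.mul_mem_mul ha hb
    rw [component, component, Submodule.span_mul_span] at hab
    refine Submodule.span_mono ?_ hab
    rintro _ ⟨_, ⟨w, hw, rfl⟩, _, ⟨w', hw', rfl⟩, rfl⟩
    refine ⟨w ++ w', ?_, by simp [monomial]⟩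
    simp only [Set.mem_ofPred_eq] at hw hw' ⊢
    rw [← hw, ← hw']
    simp [wordDeg]
  invol := invol F G
  invol_mul := invol_mul F G
  invol_invol := invol_invol F G
  map_invol := by
    refine GStarAlgebra.map_eq_of_forall_mem _ _ (invol_invol F G) fun g a ha => ?_
    induction ha using Submodule.span_induction with
    | mem a ha =>
      obtain ⟨w, hw, rfl⟩ := ha
      rw [invol_monomial]
      refine Submodule.subset_span ⟨_, ?_, rfl⟩
      simp only [Set.mem_ofPred_eq] at hw ⊢
      rw [wordDeg_reverse, hw]
    | zero => simp
    | add a b _ _ ha hb => rw [map_add]; exact add_mem ha hb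
    | smul r a _ ha => rw [map_smul]; exact Submodule.smul_mem _ _ ha

variable {F G}

/-- The variable `x_{k,g}` of the free `(G, *)`-algebra. -/
noncomputable def X (k : ℕ) (g : G) : FreeAlgebra F (Letter G) := FreeAlgebra.ι F (Letter.x k g)

/-- The variable `x_{k,g}^*` of the free `(G, *)`-algebra. -/
noncomputable def Xs (k : ℕ) (g : G) : FreeAlgebra F (Letter G) := FreeAlgebra.ι F (Letter.xs k g)

/-- `T_G^*(A)`: the set of `(G, *)`-polynomial identities of a `(G, *)`-algebra `A`. -/
def identities [Group G] {A : Type w} [Ring A] [Algebra F A] (S : GStarAlgebra F G A) :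
    Set (FreeAlgebra F (Letter G)) :=
  {f | ∀ φ : FreeAlgebra F (Letter G) →ₐ[F] A, (algebra F G).IsHom S φ → φ f = 0}

/-- A `T_G^*`-ideal: a two-sided ideal closed under all `(G, *)`-endomorphisms. -/
def IsTIdeal [Group G] (I : TwoSidedIdeal (FreeAlgebra F (Letter G))) : Prop :=
  ∀ φ : FreeAlgebra F (Letter G) →ₐ[F] FreeAlgebra F (Letter G),
    (algebra F G).IsHom (algebra F G) φ → ∀ f ∈ I, φ f ∈ I

/-- The `T_G^*`-ideal generated by `S`: the intersection of all `T_G^*`-ideals containing `S`. -/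
noncomputable def tIdealSpan [Group G] (S : Set (FreeAlgebra F (Letter G))) :
    TwoSidedIdeal (FreeAlgebra F (Letter G)) :=
  sInf {I | IsTIdeal I ∧ ∀ f ∈ S, f ∈ I}

end FreeGStar

namespace MatrixGStar

variable (F : Type u) {G : Type v} [Field F] [Group G] {n : ℕ} (γ : Fin n → G)

/-- The component of degree `g` of the elementary grading defined by `(γ_1, …, γ_n)`: the span
of the matrix units `e_{ij}` with `γ_i⁻¹ γ_j = g`. -/
def component (g : G) : Submodule F (Matrix (Fin n) (Fin n) F) :=
  Submodule.span F {a | ∃ i j : Fin n, (γ i)⁻¹ * γ j = g ∧ a = Matrix.single i j 1}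

theorem component_eq (g : G) : component F γ g = Submodule.span F
    (Matrix.stdBasis F (Fin n) (Fin n) '' {p | (γ p.1)⁻¹ * γ p.2 = g}) := by
  unfold component
  congr 1
  ext a
  constructor
  · rintro ⟨i, j, h, rfl⟩
    exact ⟨(i, j), h, Matrix.stdBasis_eq_single F i j⟩
  · rintro ⟨⟨i, j⟩, h, rfl⟩
    exact ⟨i, j, h, Matrix.stdBasis_eq_single F i j⟩

/-- `M_n(F)` with the elementary grading defined by `(γ_1, …, γ_n)` and the transpose
involution. -/
def algebra : GStarAlgebra F G (Matrix (Fin n) (Fin n) F) where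
  component := component F γ
  indep := by
    rw [funext (component_eq F γ)]
    exact GStarAlgebra.indep_of_basis (Matrix.stdBasis F (Fin n) (Fin n)) fun p => (γ p.1)⁻¹ * γ p.2
  iSup_eq_top := by
    rw [iSup_congr (component_eq F γ)]
    exact GStarAlgebra.iSup_of_basis (Matrix.stdBasis F (Fin n) (Fin n)) fun p => (γ p.1)⁻¹ * γ p.2
  mul_mem := by
    intro g h a b ha hb
    have hab := Submodule.mul_mem_mul ha hb
    rw [component, component, Submodule.span_mul_span] at hab
    refine Submodule.span_le.2 ?_ hab
    rintro _ ⟨_, ⟨i, j, rfl, rfl⟩, _, ⟨k, l, rfl, rfl⟩, rfl⟩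
    by_cases hjk : j = k
    · subst hjk
      refine Submodule.subset_span ⟨i, l, by group, by simp⟩
    · simp [hjk]
  invol := (Matrix.transposeLinearEquiv (Fin n) (Fin n) F F).toLinearMap
  invol_mul := fun a b => Matrix.transpose_mul a b
  invol_invol := fun a => Matrix.transpose_transpose a
  map_invol := by
    refine GStarAlgebra.map_eq_of_forall_mem _ _ (fun a => Matrix.transpose_transpose a)
      fun g a ha => ?_
    induction ha using Submodule.span_induction with
    | mem a ha =>
      obtain ⟨i, j, rfl, rfl⟩ := ha
      exact Submodule.subset_span ⟨j, i, by group, by simp⟩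
    | zero => simp
    | add a b _ _ ha hb => rw [map_add]; exact add_mem ha hb
    | smul r a _ ha => rw [map_smul]; exact Submodule.smul_mem _ _ ha

/-- The proposed generators: `x_{1,e} x_{2,e} - x_{2,e} x_{1,e}`; `x_{1,e} - x_{1,e}^*`;
`x_{1,g}` for `g` outside the support of `M_n(F)`; and the monomials of degree (length) at most
`2n - 1` that are `(G, *)`-identities of `M_n(F)`. -/
def generators : Set (FreeAlgebra F (Letter G)) :=
  {FreeGStar.X 1 1 * FreeGStar.X 2 1 - FreeGStar.X 2 1 * FreeGStar.X 1 1}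
    ∪ {FreeGStar.X 1 1 - FreeGStar.Xs 1 1}
    ∪ {f | ∃ g : G, g ∉ (algebra F γ).support ∧ f = FreeGStar.X 1 g}
    ∪ {f | ∃ w : List (Letter G), w.length ≤ 2 * n - 1 ∧ f = FreeGStar.monomial F w ∧
        f ∈ FreeGStar.identities (algebra F γ)}

end MatrixGStar

/-! A word is read as a walk in the Cayley graph of `G` on which `x_{k,g}` leads from `a` to `a g`
and `x_{k,g}^*` runs along the same edge backwards. At generic homogeneous matrices the entry
`(i,j)` of a monomial is the product of the edge variables of the walk from `γ i`, if that walk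
stays among the `γ i` and ends at `γ j`, and is `0` otherwise (`genericEval_monomial`). Over an
infinite field, identities vanish there.

Hence in an identity a word with a walk that stays shares its edge multiset with another word of the
support. Two such words are congruent modulo `u = u^*` for `u` of degree `e` (`eq_of_edges_eq`, by
reversing closed subwalks; commutation is included, since `uv = (uv)^* = v^* u^* = vu`), so one can
replace the other. A word none of whose walks stays can be cut into at most `n ≤ 2n - 1` blocks with
the same defect (`exists_blocks`), so it follows from a short monomial identity. Induction on the
size of the support finishes the proof. -/

/-! ### Words as walks in the Cayley graph. -/

namespace Letter

variable {G : Type v} [Group G]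

/-- The undirected edge of the Cayley graph traversed by a letter read from the vertex `a`. -/
def edge (a : G) : Letter G → ℕ × G × G
  | x k g => (k, g, a)
  | xs k g => (k, g, a * g⁻¹)

theorem edge_swap (a : G) (l : Letter G) : l.swap.edge (a * l.deg) = l.edge a := by
  cases l <;> simp [swap, deg, edge]

/-- An undirected edge can be traversed in only two ways: forwards or backwards. -/
theorem eq_or_eq_swap_of_edge_eq {a b : G} {l m : Letter G} (h : l.edge a = m.edge b) :
    (m = l ∧ b = a) ∨ (m = l.swap ∧ b = a * l.deg) := by
  cases l <;> cases m <;> simp only [edge, Prod.mk.injEq] at h <;> obtain ⟨rfl, rfl, h⟩ := h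
  · exact Or.inl ⟨rfl, h.symm⟩
  · exact Or.inr ⟨rfl, by simp [deg, h]⟩
  · exact Or.inr ⟨rfl, by simp [deg, h]⟩
  · exact Or.inl ⟨rfl, (mul_right_cancel h).symm⟩

end Letter

namespace FreeGStar

section Words

variable {G : Type v}

/-- The involution on words. -/
def starWord (w : List (Letter G)) : List (Letter G) := (w.map Letter.swap).reverse

theorem starWord_append (u v : List (Letter G)) :
    starWord (u ++ v) = starWord v ++ starWord u := by simp [starWord]

theorem starWord_cons (l : Letter G) (w : List (Letter G)) :
    starWord (l :: w) = starWord w ++ [l.swap] := by simp [starWord]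

variable [Group G]

@[simp] theorem wordDeg_nil : wordDeg ([] : List (Letter G)) = 1 := rfl

@[simp] theorem wordDeg_cons (l : Letter G) (w : List (Letter G)) :
    wordDeg (l :: w) = l.deg * wordDeg w := by simp [wordDeg]

@[simp] theorem wordDeg_append (u v : List (Letter G)) :
    wordDeg (u ++ v) = wordDeg u * wordDeg v := by simp [wordDeg]

@[simp] theorem wordDeg_starWord (w : List (Letter G)) : wordDeg (starWord w) = (wordDeg w)⁻¹ :=
  wordDeg_reverse G w

/-- The multiset of undirected edges of the walk that starts at `a` and reads a given word. -/
def edges : G → List (Letter G) → Multiset (ℕ × G × G)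
  | _, [] => 0
  | a, l :: w => l.edge a ::ₘ edges (a * l.deg) w

@[simp] theorem edges_nil (a : G) : edges a [] = 0 := rfl

@[simp] theorem edges_cons (a : G) (l : Letter G) (w : List (Letter G)) :
    edges a (l :: w) = l.edge a ::ₘ edges (a * l.deg) w := rfl

@[simp] theorem edges_append (a : G) (u v : List (Letter G)) :
    edges a (u ++ v) = edges a u + edges (a * wordDeg u) v := by
  induction u generalizing a with
  | nil => simp
  | cons l u ih => simp [ih, mul_assoc]

theorem edges_starWord (a : G) (w : List (Letter G)) :
    edges (a * wordDeg w) (starWord w) = edges a w := by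
  induction w generalizing a with
  | nil => simp [starWord]
  | cons l w ih =>
    have h := ih (a * l.deg)
    rw [mul_assoc] at h
    rw [starWord_cons, edges_append, wordDeg_cons, h, edges_cons, ← Multiset.singleton_add,
      add_comm, ← mul_assoc, wordDeg_starWord, mul_inv_cancel_right]
    simp [Letter.edge_swap]

theorem edges_starWord_of_wordDeg_eq_one (a : G) {w : List (Letter G)} (hw : wordDeg w = 1) :
    edges a (starWord w) = edges a w := by
  simpa [hw] using edges_starWord a w

theorem exists_append_of_mem_edges {a : G} {w : List (Letter G)} {e : ℕ × G × G}
    (h : e ∈ edges a w) : ∃ p l q, w = p ++ l :: q ∧ e = l.edge (a * wordDeg p) := by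
  induction w generalizing a with
  | nil => simp at h
  | cons l w ih =>
    rw [edges_cons, Multiset.mem_cons] at h
    rcases h with rfl | h
    · exact ⟨[], l, w, rfl, by simp⟩
    · obtain ⟨p, m, q, rfl, rfl⟩ := ih h
      exact ⟨l :: p, m, q, rfl, by simp [mul_assoc]⟩

/-- The vertices of the walk that starts at `a` and reads a given word. -/
def vertices (a : G) (w : List (Letter G)) : Set G :=
  {c | ∃ u v, w = u ++ v ∧ c = a * wordDeg u}

theorem self_mem_vertices (a : G) (w : List (Letter G)) : a ∈ vertices a w :=
  ⟨[], w, rfl, by simp⟩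

theorem mem_vertices_of_edge_mem {a b : G} {l : Letter G} {w : List (Letter G)}
    (h : l.edge b ∈ edges a w) : b ∈ vertices a w ∧ b * l.deg ∈ vertices a w := by
  obtain ⟨p, m, q, rfl, he⟩ := exists_append_of_mem_edges h
  have h₁ : a * wordDeg p ∈ vertices a (p ++ m :: q) := ⟨p, m :: q, rfl, rfl⟩
  have h₂ : a * wordDeg p * m.deg ∈ vertices a (p ++ m :: q) :=
    ⟨p ++ [m], q, by simp, by simp [mul_assoc]⟩
  rcases Letter.eq_or_eq_swap_of_edge_eq he with ⟨rfl, hb⟩ | ⟨rfl, hb⟩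
  · rw [hb] at h₁ h₂
    exact ⟨h₁, h₂⟩
  · rw [hb] at h₁ h₂
    rw [Letter.deg_swap, mul_inv_cancel_right] at h₂
    exact ⟨h₂, h₁⟩

/-- A walk whose edges belong to two walks without common vertices stays on one of them. -/
theorem notMem_edges_of_disjoint {a b c : G} {p q w : List (Letter G)}
    (hpq : Disjoint (vertices a p) (vertices b q)) (hc : c ∉ vertices a p)
    (hw : ∀ e ∈ edges c w, e ∈ edges a p ∨ e ∈ edges b q) : ∀ e ∈ edges c w, e ∉ edges a p := by
  induction w generalizing c with
  | nil => simp
  | cons l w ih =>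
    simp only [edges_cons, Multiset.mem_cons, forall_eq_or_imp] at hw ⊢
    have hl : l.edge c ∉ edges a p := fun h => hc (mem_vertices_of_edge_mem h).1
    refine ⟨hl, ih ?_ hw.2⟩
    -- The first edge lies on the walk of `q`, so its far end is again off the walk of `p`.
    have := (mem_vertices_of_edge_mem (hw.1.resolve_left hl)).2
    exact fun h => Set.disjoint_left.1 hpq h this

/-! ### Rearranging walks with equal edges. -/

/-- A multiplicative function on words that does not distinguish a word of trivial degree from
its star. -/
structure StarInvariant {M : Type*} [Monoid M] (φ : List (Letter G) → M) : Prop where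
  map_append : ∀ u v, φ (u ++ v) = φ u * φ v
  map_star : ∀ u, wordDeg u = 1 → φ u = φ (starWord u)

namespace StarInvariant

variable {M : Type*} [Monoid M] {φ : List (Letter G) → M}

/-- The initial segment `p l^*` is a closed walk; reversing it gives `l p^*`, which begins with `l`
and has the same edges. -/
theorem exists_cons_of_swap (hφ : StarInvariant φ) (a : G) (l : Letter G) (p q : List (Letter G))
    (hp : wordDeg p = l.deg) :
    ∃ w, edges a (l :: w) = edges a (p ++ l.swap :: q) ∧ φ (p ++ l.swap :: q) = φ (l :: w) := by
  have hu : wordDeg (p ++ [l.swap]) = 1 := by simp [hp, Letter.deg_swap]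
  have hs : starWord (p ++ [l.swap]) = l :: starWord p := by
    simp [starWord, Letter.swap_swap]
  refine ⟨starWord p ++ q, ?_, ?_⟩
  · have h := edges_starWord_of_wordDeg_eq_one a hu
    have e₁ : l :: (starWord p ++ q) = starWord (p ++ [l.swap]) ++ q := by rw [hs]; rfl
    have e₂ : p ++ l.swap :: q = (p ++ [l.swap]) ++ q := by simp
    rw [e₁, e₂, edges_append, edges_append a (p ++ [l.swap]), h, wordDeg_starWord, hu, inv_one]
  · rw [show p ++ l.swap :: q = (p ++ [l.swap]) ++ q by simp, hφ.map_append, hφ.map_star _ hu, hs,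
      ← hφ.map_append]
    rfl

/-- The walk `w` must use the first edge of `l w'`. If it does so backwards, the preceding lemma
applies. If it does so forwards, `w = p l q` with `p` closed, and either `p` is empty or `p` and `q`
meet in a vertex, which allows a reversal that makes the edge traversed backwards. -/
theorem exists_cons (hφ : StarInvariant φ) {a : G} {l : Letter G} {w w' : List (Letter G)}
    (h : edges a w = edges a (l :: w')) :
    ∃ v, edges a (l :: v) = edges a w ∧ φ w = φ (l :: v) := by
  obtain ⟨p, m, q, rfl, hm⟩ := exists_append_of_mem_edges
    (show l.edge a ∈ edges a w by rw [h]; simp)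
  rcases Letter.eq_or_eq_swap_of_edge_eq hm with ⟨rfl, hp⟩ | ⟨rfl, hp⟩
  swap
  · exact hφ.exists_cons_of_swap a l p q (mul_left_cancel hp)
  have hp1 : wordDeg p = 1 := by simpa using hp
  by_cases hd : Disjoint (vertices a p) (vertices (a * m.deg) q)
  · rcases p with _ | ⟨l₀, p⟩
    · exact ⟨q, rfl, rfl⟩
    -- The walk `w'` starts on `q` and uses exactly the edges of `p` and `q`. As these have no
    -- common vertex it never reaches `p`, so the first edge of `p` is missed.
    · exfalso
      have hw : edges (a * m.deg) w' = edges a (l₀ :: p) + edges (a * m.deg) q := by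
        rw [edges_append, hp1, mul_one, edges_cons _ m, edges_cons _ m, Multiset.add_cons,
          Multiset.cons_inj_right] at h
        exact h.symm
      have hb : a * m.deg ∉ vertices a (l₀ :: p) :=
        Set.disjoint_right.1 hd (self_mem_vertices _ _)
      refine notMem_edges_of_disjoint (w := w') hd hb (fun e he => ?_) (l₀.edge a) ?_ ?_
      · rwa [hw, Multiset.mem_add] at he
      · simp [hw]
      · simp
  · obtain ⟨_, ⟨p₁, p₂, rfl, rfl⟩, q₁, q₂, rfl, hc⟩ := Set.not_disjoint_iff.1 hd
    rw [mul_assoc] at hc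
    replace hc := mul_left_cancel hc
    rw [wordDeg_append] at hp1
    -- At the common vertex, `p₂ m q₁` is a closed walk; its reversal traverses `m` backwards.
    have hu : wordDeg (p₂ ++ m :: q₁) = 1 := by
      rw [wordDeg_append, wordDeg_cons, ← hc]
      exact mul_eq_one_comm.1 hp1
    have e₁ : (p₁ ++ p₂) ++ m :: (q₁ ++ q₂) = p₁ ++ ((p₂ ++ m :: q₁) ++ q₂) := by simp
    have e₂ : (p₁ ++ starWord q₁) ++ m.swap :: (starWord p₂ ++ q₂) =
        p₁ ++ (starWord (p₂ ++ m :: q₁) ++ q₂) := by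
      simp [starWord_append, starWord_cons]
    obtain ⟨v, hv₁, hv₂⟩ := hφ.exists_cons_of_swap a m (p₁ ++ starWord q₁) (starWord p₂ ++ q₂)
      (by simp [hc])
    refine ⟨v, ?_, ?_⟩
    · rw [hv₁, e₁, e₂, edges_append, edges_append, edges_append a p₁,
        edges_append _ (p₂ ++ m :: q₁), edges_starWord_of_wordDeg_eq_one _ hu, wordDeg_starWord,
        hu, inv_one]
    · rw [← hv₂, e₁, e₂, hφ.map_append, hφ.map_append, hφ.map_append p₁, hφ.map_append (starWord _),
        hφ.map_star _ hu]

/-- Two walks with the same origin and the same edges have the same value under every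
star-invariant function. -/
theorem eq_of_edges_eq (hφ : StarInvariant φ) {a : G} {w w' : List (Letter G)}
    (h : edges a w = edges a w') : φ w = φ w' := by
  induction w' generalizing a w with
  | nil => cases w <;> simp_all
  | cons l w' ih =>
    obtain ⟨v, hv, hφv⟩ := hφ.exists_cons h
    rw [h, edges_cons, edges_cons, Multiset.cons_inj_right] at hv
    rw [hφv, ← List.singleton_append, ← List.singleton_append (l := w'), hφ.map_append,
      hφ.map_append, ih hv]

end StarInvariant

/-! ### Grouping letters into few blocks. -/

/-- The walk from `a` along the given steps stays in `Γ`. -/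
def Stays (Γ : Set G) : G → List G → Prop
  | a, [] => a ∈ Γ
  | a, g :: s => a ∈ Γ ∧ Stays Γ (a * g) s

theorem Stays.mem {Γ : Set G} {a : G} {s : List G} (h : Stays Γ a s) : a ∈ Γ := by
  cases s with
  | nil => exact h
  | cons g s => exact h.1

/-- If every walk along `w` from a point of `T` leaves `Γ`, this is seen after grouping the letters
of an initial segment of `w` into at most `#(T ∩ Γ)` blocks. -/
theorem exists_blocks (Γ : Set G) [DecidablePred (· ∈ Γ)] (w : List (Letter G)) (T : Finset G)
    (hT : ∀ a ∈ T, ¬ Stays Γ a (w.map Letter.deg)) :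
    ∃ (L : List (List (Letter G))) (r : List (Letter G)), w = L.flatten ++ r ∧
      L.length ≤ (T.filter (· ∈ Γ)).card ∧ ∀ a ∈ T, ¬ Stays Γ a (L.map wordDeg) := by
  classical
  induction w generalizing T with
  | nil => exact ⟨[], [], by simp, by simp, by simpa using hT⟩
  | cons l w ih =>
    set T₀ := T.filter (· ∈ Γ)
    set T₁ := T₀.image (· * l.deg)
    have hcard : T₁.card = T₀.card := Finset.card_image_of_injective _ (mul_left_injective _)
    have hmem : ∀ a ∈ T, a ∈ Γ → a * l.deg ∈ T₁ := fun a ha haΓ =>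
      Finset.mem_image_of_mem _ (Finset.mem_filter.2 ⟨ha, haΓ⟩)
    obtain ⟨L, r, rfl, hL, hs⟩ := ih T₁ (by
      intro b hb
      obtain ⟨a, ha, rfl⟩ := Finset.mem_image.1 hb
      obtain ⟨ha, haΓ⟩ := Finset.mem_filter.1 ha
      exact fun h => hT a ha ⟨haΓ, h⟩)
    -- If `l` expels no walk from `Γ`, it is absorbed into the next block. Otherwise it becomes a
    -- block of its own, paid for by the strict drop in the number of surviving walks.
    by_cases hsub : ∀ b ∈ T₁, b ∈ Γ
    · rw [Finset.filter_true_of_mem hsub, hcard] at hL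
      cases L with
      | nil =>
        -- No block is needed for `T₁ ⊆ Γ`, so `T₁` is empty and no point of `T` lies in `Γ`.
        refine ⟨[], l :: r, by simp, by simp, fun a ha haΓ => ?_⟩
        exact hs _ (hmem a ha haΓ) (hsub _ (hmem a ha haΓ))
      | cons u L =>
        refine ⟨(l :: u) :: L, r, by simp, hL, fun a ha h => ?_⟩
        refine hs _ (hmem a ha h.1) ⟨hsub _ (hmem a ha h.1), ?_⟩
        simpa [mul_assoc] using h.2
    · refine ⟨[l] :: L, r, by simp, ?_, fun a ha h => ?_⟩
      · rw [← hcard, List.length_cons]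
        refine Nat.lt_of_le_of_lt hL (Finset.card_lt_card ?_)
        refine (Finset.filter_ssubset).2 ?_
        simpa using hsub
      · refine hs _ (hmem a ha h.1) ?_
        simpa using h.2

end Words

/-! ### Monomials, substitutions and `T_G^*`-ideals. -/

section Monomials

variable {F : Type u} {G : Type v} [Field F]

theorem monomial_append (u v : List (Letter G)) :
    monomial F (u ++ v) = monomial F u * monomial F v := by simp [monomial]

theorem monomial_cons (l : Letter G) (w : List (Letter G)) :
    monomial F (l :: w) = FreeAlgebra.ι F l * monomial F w := by simp [monomial]

theorem span_range_monomial :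
    Submodule.span F (Set.range (monomial F : List (Letter G) → _)) = ⊤ := by
  rw [← (FreeAlgebra.basisFreeMonoid F (Letter G)).span_eq]
  congr 1
  ext a
  constructor
  · rintro ⟨w, rfl⟩
    exact ⟨FreeMonoid.ofList w, basis_apply F G w⟩
  · rintro ⟨w, rfl⟩
    exact ⟨FreeMonoid.toList w, (basis_apply F G (FreeMonoid.toList w)).symm⟩

end Monomials

section Substitution

variable {F : Type u} {G : Type v} {A : Type w} [Field F] [Group G] [Ring A] [Algebra F A]

theorem monomial_mem (w : List (Letter G)) : monomial F w ∈ component F G (wordDeg w) :=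
  Submodule.subset_span ⟨w, rfl, rfl⟩

theorem one_mem_component : (1 : FreeAlgebra F (Letter G)) ∈ component F G 1 :=
  monomial_mem (F := F) ([] : List (Letter G))

theorem _root_.GStarAlgebra.invol_one (S : GStarAlgebra F G A) : S.invol 1 = 1 := by
  have h := S.invol_mul 1 (S.invol 1)
  rw [one_mul, S.invol_invol, one_mul] at h
  exact h.symm

/-- The algebra homomorphism with `x_{k,g} ↦ a k g` and `x_{k,g}^* ↦ (a k g)^*`. -/
noncomputable def substitution (S : GStarAlgebra F G A) (a : ℕ → G → A) :
    FreeAlgebra F (Letter G) →ₐ[F] A :=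
  FreeAlgebra.lift F fun
    | .x k g => a k g
    | .xs k g => S.invol (a k g)

@[simp] theorem substitution_X (S : GStarAlgebra F G A) (a : ℕ → G → A) (k : ℕ) (g : G) :
    substitution S a (FreeAlgebra.ι F (Letter.x k g)) = a k g := by simp [substitution]

@[simp] theorem substitution_Xs (S : GStarAlgebra F G A) (a : ℕ → G → A) (k : ℕ) (g : G) :
    substitution S a (FreeAlgebra.ι F (Letter.xs k g)) = S.invol (a k g) := by
  simp [substitution]

theorem _root_.GStarAlgebra.invol_mem (S : GStarAlgebra F G A) {g : G} {a : A}
    (ha : a ∈ S.component g) : S.invol a ∈ S.component g⁻¹ := by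
  rw [← S.map_invol]
  exact Submodule.mem_map_of_mem ha

theorem isHom_substitution (S : GStarAlgebra F G A) (h1 : 1 ∈ S.component 1) {a : ℕ → G → A}
    (ha : ∀ k g, a k g ∈ S.component g) : (algebra F G).IsHom S (substitution S a) where
  map_component := by
    intro g f hf
    change f ∈ component F G g at hf
    induction hf using Submodule.span_induction with
    | zero => simp
    | add x y _ _ hx hy => rw [map_add]; exact add_mem hx hy
    | smul r x _ hx => rw [map_smul]; exact Submodule.smul_mem _ _ hx
    | mem f hf =>
      obtain ⟨w, rfl, rfl⟩ := hf
      induction w with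
      | nil => simpa [monomial] using h1
      | cons l w ih =>
        rw [monomial_cons, map_mul, wordDeg_cons]
        refine S.mul_mem ?_ ih
        cases l with
        | x k g => simpa [Letter.deg] using ha k g
        | xs k g => simpa [Letter.deg] using S.invol_mem (ha k g)
  map_invol := by
    intro f
    change substitution S a (invol F G f) = _
    induction f using FreeAlgebra.induction with
    | grade0 r =>
      rw [invol_algebraMap, AlgHom.commutes, Algebra.algebraMap_eq_smul_one, map_smul,
        S.invol_one]
    | grade1 l =>
      rw [invol_ι]
      cases l <;> simp [Letter.swap, S.invol_invol]
    | mul f g hf hg => simp only [invol_mul, map_mul, S.invol_mul, hf, hg]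
    | add f g hf hg => simp only [map_add, hf, hg]

theorem IsTIdeal.substitution_mem {I : TwoSidedIdeal (FreeAlgebra F (Letter G))} (hI : IsTIdeal I)
    {a : ℕ → G → FreeAlgebra F (Letter G)} (ha : ∀ k g, a k g ∈ component F G g)
    {f : FreeAlgebra F (Letter G)} (hf : f ∈ I) : substitution (algebra F G) a f ∈ I :=
  hI _ (isHom_substitution (algebra F G) one_mem_component ha) f hf

/-- Substitute the monomial of `u`, which has degree `e`, for `x_{k,e}`. -/
theorem IsTIdeal.sub_star_mem {I : TwoSidedIdeal (FreeAlgebra F (Letter G))} (hI : IsTIdeal I)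
    {k : ℕ} (h : X k 1 - Xs k 1 ∈ I) {u : List (Letter G)} (hu : wordDeg u = 1) :
    monomial F u - monomial F (starWord u) ∈ I := by
  classical
  have := hI.substitution_mem (a := fun _ g => if g = 1 then monomial F u else 0) ?_ h
  · have e : (algebra F G).invol (monomial F u) = monomial F (starWord u) := invol_monomial F G u
    simpa [X, Xs, e] using this
  · intro _ g
    split_ifs with hg
    · rw [hg, ← hu]; exact monomial_mem u
    · exact zero_mem _

/-- Replacing each block of a word by a new variable of the same degree. -/
theorem IsTIdeal.monomial_flatten_mem {I : TwoSidedIdeal (FreeAlgebra F (Letter G))}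
    (hI : IsTIdeal I) (L : List (List (Letter G)))
    (h : monomial F (List.ofFn fun i : Fin L.length => Letter.x i (wordDeg (L.get i))) ∈ I) :
    monomial F L.flatten ∈ I := by
  classical
  -- The default `[]` only affects variables with index at least `L.length`, which do not occur in
  -- the monomial; the test on the degree keeps the substitution graded.
  have := hI.substitution_mem (a := fun k g => if wordDeg (L.getD k []) = g
    then monomial F (L.getD k []) else 0) ?_ h
  · convert this using 1
    have e : ∀ L : List (List (Letter G)),
        monomial F L.flatten = (L.map (monomial F)).prod := by
      intro L
      induction L with
      | nil => simp [monomial]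
      | cons u L ih => rw [List.flatten_cons, monomial_append, ih]; simp
    rw [e, monomial, map_list_prod, List.map_ofFn, List.map_ofFn]
    congr 1
    apply List.ext_get
    · simp
    · intro i hi hi'
      simp at hi
      simp [hi]
  · intro k g
    split_ifs with hg
    · rw [← hg]; exact monomial_mem _
    · exact zero_mem _

/-- The identities of a `(G, *)`-algebra form a two-sided ideal. -/
def identitiesIdeal (S : GStarAlgebra F G A) : TwoSidedIdeal (FreeAlgebra F (Letter G)) :=
  TwoSidedIdeal.mk' (identities S) (fun φ _ => map_zero φ)
    (fun hf hg φ hφ => by rw [map_add, hf φ hφ, hg φ hφ, add_zero])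
    (fun hf φ hφ => by rw [map_neg, hf φ hφ, neg_zero])
    (fun hf φ hφ => by rw [map_mul, hf φ hφ, mul_zero])
    (fun hf φ hφ => by rw [map_mul, hf φ hφ, zero_mul])

theorem mem_identitiesIdeal {S : GStarAlgebra F G A} {f : FreeAlgebra F (Letter G)} :
    f ∈ identitiesIdeal S ↔ f ∈ identities S := by
  exact TwoSidedIdeal.mem_mk' _ _ _ _ _ _ _

theorem isTIdeal_identitiesIdeal (S : GStarAlgebra F G A) : IsTIdeal (identitiesIdeal S) := by
  intro ψ hψ f hf
  rw [mem_identitiesIdeal] at hf ⊢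
  intro φ hφ
  refine hf (φ.comp ψ) ⟨fun g a ha => ?_, fun a => ?_⟩
  · exact hφ.map_component g _ (hψ.map_component g a ha)
  · rw [AlgHom.comp_apply, hψ.map_invol, hφ.map_invol, AlgHom.comp_apply]

theorem mem_tIdealSpan {s : Set (FreeAlgebra F (Letter G))} {f : FreeAlgebra F (Letter G)} :
    f ∈ tIdealSpan s ↔ ∀ I, IsTIdeal I → (∀ f ∈ s, f ∈ I) → f ∈ I := by
  simp [tIdealSpan, TwoSidedIdeal.mem_sInf]

theorem isTIdeal_tIdealSpan (s : Set (FreeAlgebra F (Letter G))) : IsTIdeal (tIdealSpan s) := by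
  intro φ hφ f hf
  rw [mem_tIdealSpan] at hf ⊢
  exact fun I hI hs => hI φ hφ f (hf I hI hs)

theorem subset_tIdealSpan {s : Set (FreeAlgebra F (Letter G))} {f : FreeAlgebra F (Letter G)}
    (hf : f ∈ s) : f ∈ tIdealSpan s :=
  mem_tIdealSpan.2 fun _ _ hs => hs f hf

/-- Words whose walks from some vertex have the same edges are congruent modulo a `T_G^*`-ideal
in which `x_{k,e}` is symmetric. -/
theorem IsTIdeal.sub_mem_of_edges_eq {I : TwoSidedIdeal (FreeAlgebra F (Letter G))}
    (hI : IsTIdeal I) {k : ℕ} (h : X k 1 - Xs k 1 ∈ I) {a : G} {w w' : List (Letter G)}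
    (hw : edges a w = edges a w') : monomial F w - monomial F w' ∈ I := by
  -- The class of a monomial in the quotient by `I` is a star-invariant function of its word.
  have hφ : StarInvariant fun w : List (Letter G) => I.ringCon.mk' (monomial F w) :=
    ⟨fun u v => by rw [monomial_append, map_mul],
      fun u hu => (RingCon.eq _).2 ((I.rel_iff _ _).2 (hI.sub_star_mem h hu))⟩
  exact (I.rel_iff _ _).1 ((RingCon.eq _).1 (hφ.eq_of_edges_eq hw))

end Substitution

end FreeGStar

/-! ### Identities of the matrix algebra. -/

namespace MatrixGStar

open FreeGStar

variable {F : Type u} {G : Type v} [Field F] [Group G] {n : ℕ} {γ : Fin n → G}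

/-- In this form a nonzero entry `(i,j)` is a step of degree `g` from `γ i` to `γ j`. -/
theorem mem_component {g : G} {M : Matrix (Fin n) (Fin n) F} :
    M ∈ component F γ g ↔ ∀ i j, M i j ≠ 0 → γ i * g = γ j := by
  constructor
  · intro h
    induction h using Submodule.span_induction with
    | mem M hM =>
      obtain ⟨i, j, rfl, rfl⟩ := hM
      intro i' j' h
      rw [Matrix.single_apply] at h
      obtain ⟨rfl, rfl⟩ : i = i' ∧ j = j' := by
        by_contra hne
        exact h (if_neg hne)
      simp
    | zero => simp
    | add M N _ _ hM hN =>
      intro i j h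
      by_cases hMij : M i j = 0
      · refine hN i j fun hNij => h ?_
        simp [hMij, hNij]
      · exact hM i j hMij
    | smul r M _ hM =>
      intro i j h
      exact hM i j fun h0 => h (by simp [h0])
  · intro h
    rw [Matrix.matrix_eq_sum_single M]
    refine Submodule.sum_mem _ fun i _ => Submodule.sum_mem _ fun j _ => ?_
    by_cases hij : M i j = 0
    · simp [hij]
    · rw [show Matrix.single i j (M i j) = M i j • Matrix.single i j (1 : F) by simp]
      refine Submodule.smul_mem _ _ (Submodule.subset_span ⟨i, j, ?_, rfl⟩)
      rw [← h i j hij, inv_mul_cancel_left]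

theorem one_mem_component : (1 : Matrix (Fin n) (Fin n) F) ∈ component F γ 1 := by
  rw [mem_component]
  intro i j h
  rw [Matrix.one_apply] at h
  obtain rfl : i = j := by
    by_contra hne
    exact h (if_neg hne)
  simp

/-- A nonzero entry of a value of a monomial gives a walk that stays among the `γ i`. -/
theorem stays_of_ne_zero {φ : FreeAlgebra F (Letter G) →ₐ[F] Matrix (Fin n) (Fin n) F}
    (hφ : (FreeGStar.algebra F G).IsHom (algebra F γ) φ) (w : List (Letter G)) {i j : Fin n}
    (h : φ (monomial F w) i j ≠ 0) : Stays (Set.range γ) (γ i) (w.map Letter.deg) := by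
  induction w generalizing i with
  | nil => exact ⟨i, rfl⟩
  | cons l w ih =>
    rw [monomial_cons, map_mul, Matrix.mul_apply] at h
    obtain ⟨k, -, hk⟩ := Finset.exists_ne_zero_of_sum_ne_zero h
    have hl : FreeAlgebra.ι F l ∈ FreeGStar.component F G l.deg := by
      simpa [monomial] using monomial_mem (F := F) [l]
    have h₁ := mem_component.1 (hφ.map_component _ _ hl) i k (left_ne_zero_of_mul hk)
    refine ⟨⟨i, rfl⟩, ?_⟩
    rw [h₁]
    exact ih (right_ne_zero_of_mul hk)

theorem monomial_mem_identities {w : List (Letter G)}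
    (h : ∀ i, ¬ Stays (Set.range γ) (γ i) (w.map Letter.deg)) :
    monomial F w ∈ identities (algebra F γ) := by
  intro φ hφ
  ext i j
  by_contra hne
  exact h i (stays_of_ne_zero hφ w hne)

/-- Monomial identities follow from those of length at most `2 n - 1`. -/
theorem monomial_mem_tIdealSpan (hn : 1 ≤ n) {w : List (Letter G)}
    (h : ∀ i, ¬ Stays (Set.range γ) (γ i) (w.map Letter.deg)) :
    monomial F w ∈ tIdealSpan (generators F γ) := by
  classical
  obtain ⟨L, r, rfl, hL, hs⟩ := exists_blocks (Set.range γ) w (Finset.univ.image γ)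
    (by simpa using h)
  have hL' : L.length ≤ n := by
    refine (hL.trans (Finset.card_filter_le _ _)).trans ?_
    simpa using Finset.card_image_le (s := Finset.univ) (f := γ)
  rw [monomial_append]
  refine TwoSidedIdeal.mul_mem_right _ _ _ ((isTIdeal_tIdealSpan _).monomial_flatten_mem L ?_)
  refine subset_tIdealSpan (Or.inr ⟨_, ?_, rfl, monomial_mem_identities fun i => ?_⟩)
  -- There are at most `n` blocks, and `n ≤ 2n - 1` because `1 ≤ n`.
  · rw [List.length_ofFn]
    omega
  · convert hs (γ i) (by simp) using 2
    rw [List.map_ofFn]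
    conv_rhs => rw [← List.ofFn_get L, List.map_ofFn]
    rfl

theorem exists_eq_diagonal (hγ : Function.Injective γ) {M : Matrix (Fin n) (Fin n) F}
    (hM : M ∈ component F γ 1) : ∃ d, M = Matrix.diagonal d := by
  refine ⟨M.diag, (Matrix.IsDiag.diagonal_diag fun i j hij => ?_).symm⟩
  by_contra h
  exact hij (hγ (by simpa using mem_component.1 hM i j h))

/-- The identities form a `T_G^*`-ideal, so only the generators need checking. As the `γ i` are
distinct, matrices of degree `e` are diagonal, hence commute and are symmetric. -/
theorem tIdealSpan_le_identities (hγ : Function.Injective γ) {f : FreeAlgebra F (Letter G)}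
    (hf : f ∈ tIdealSpan (generators F γ)) : f ∈ identities (algebra F γ) := by
  have hX : ∀ (k : ℕ) (g : G), X (F := F) k g ∈ FreeGStar.component F G g := fun k g => by
    simpa [monomial, wordDeg, Letter.deg, X] using monomial_mem (F := F) [Letter.x k g]
  rw [← mem_identitiesIdeal]
  refine mem_tIdealSpan.1 hf _ (isTIdeal_identitiesIdeal _) fun f hf => ?_
  rw [mem_identitiesIdeal]
  rcases hf with ((rfl | rfl) | ⟨g, hg, rfl⟩) | ⟨w, -, -, hf⟩
  · intro φ hφ
    obtain ⟨d₁, h₁⟩ := exists_eq_diagonal hγ (hφ.map_component _ _ (hX 1 1))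
    obtain ⟨d₂, h₂⟩ := exists_eq_diagonal hγ (hφ.map_component _ _ (hX 2 1))
    simp [h₁, h₂, mul_comm]
  · intro φ hφ
    obtain ⟨d, h⟩ := exists_eq_diagonal hγ (hφ.map_component _ _ (hX 1 1))
    have hs : Xs 1 1 = (FreeGStar.algebra F G).invol (X 1 1) :=
      (invol_ι F G (Letter.x 1 1)).symm
    rw [map_sub, hs, hφ.map_invol, h, sub_eq_zero]
    exact (Matrix.diagonal_transpose d).symm
  · intro φ hφ
    have hb : (algebra F γ).component g = ⊥ := not_not.1 hg
    have := hφ.map_component _ _ (hX 1 g)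
    rwa [hb, Submodule.mem_bot] at this
  · exact hf

/-! ### Generic homogeneous matrices. -/

section Generic

open Classical in
/-- The homogeneous matrix of degree `g` with the entry `c i` in the row `i`. -/
noncomputable def homogeneousMatrix {R : Type*} [Zero R] (γ : Fin n → G) (g : G) (c : G → R) :
    Matrix (Fin n) (Fin n) R :=
  Matrix.of fun i j => if γ i * g = γ j then c (γ i) else 0

variable (F γ)

/-- The evaluation of the free algebra at generic homogeneous matrices. -/
noncomputable def genericEval : FreeAlgebra F (Letter G) →ₐ[F]
    Matrix (Fin n) (Fin n) (MvPolynomial (ℕ × G × G) F) :=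
  FreeAlgebra.lift F fun
    | .x k g => homogeneousMatrix γ g fun a => MvPolynomial.X (k, g, a)
    | .xs k g => (homogeneousMatrix γ g fun a => MvPolynomial.X (k, g, a)).transpose

variable {F γ}

open Classical in
theorem genericEval_ι (l : Letter G) (i j : Fin n) :
    genericEval F γ (FreeAlgebra.ι F l) i j =
      if γ i * l.deg = γ j then MvPolynomial.X (l.edge (γ i)) else 0 := by
  cases l with
  | x k g => 
    simp only [genericEval, homogeneousMatrix, FreeAlgebra.lift_ι_apply, Matrix.of_apply]
    rfl
  | xs k g =>
    simp only [genericEval, homogeneousMatrix, FreeAlgebra.lift_ι_apply,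
      Matrix.transpose_apply, Matrix.of_apply]
    change _ = if γ i * g⁻¹ = γ j then MvPolynomial.X (k, g, γ i * g⁻¹) else 0
    by_cases h : γ j * g = γ i
    · rw [if_pos h, if_pos (by rw [← h, mul_inv_cancel_right]), ← h, mul_inv_cancel_right]
    · rw [if_neg h, if_neg fun h' => h (by rw [← h', inv_mul_cancel_right])]

-- As the `γ i` are distinct, each row of a generic letter has at most one nonzero entry. The sum
-- over paths in a matrix product therefore has at most one nonzero term, the walk of `w` from `γ
-- i`.
open Classical in
theorem genericEval_monomial (hγ : Function.Injective γ) (w : List (Letter G)) (i j : Fin n) :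
    genericEval F γ (monomial F w) i j =
      if Stays (Set.range γ) (γ i) (w.map Letter.deg) ∧ γ i * wordDeg w = γ j then
        MvPolynomial.monomial (Multiset.toFinsupp (edges (γ i) w)) 1 else 0 := by
  induction w generalizing i with
  | nil =>
    simp [monomial, Stays, Matrix.one_apply, hγ.eq_iff]
  | cons l w ih =>
    rw [monomial_cons, map_mul, Matrix.mul_apply]
    simp only [genericEval_ι]
    by_cases hl : ∃ k, γ i * l.deg = γ k
    · obtain ⟨k, hk⟩ := hl
      rw [Finset.sum_eq_single k]
      · rw [if_pos hk, ih]
        have hS : Stays (Set.range γ) (γ i) ((l :: w).map Letter.deg) ↔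
            Stays (Set.range γ) (γ k) (w.map Letter.deg) := by
          rw [← hk]
          exact and_iff_right ⟨i, rfl⟩
        rw [hS, wordDeg_cons, ← mul_assoc, hk, edges_cons, hk]
        split_ifs
        · rw [← Multiset.singleton_add, map_add, Multiset.toFinsupp_singleton, MvPolynomial.X,
            MvPolynomial.monomial_mul, one_mul]
        · rw [mul_zero]
      · intro k' _ hk'
        rw [if_neg fun h => hk' (hγ (h.symm.trans hk)), zero_mul]
      · simp
    · rw [if_neg, Finset.sum_eq_zero]
      · intro k _
        rw [if_neg fun h => hl ⟨k, h⟩, zero_mul]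
      · rintro ⟨h, -⟩
        obtain ⟨k, hk⟩ := h.2.mem
        exact hl ⟨k, hk.symm⟩

theorem homogeneousMatrix_mem (g : G) (c : G → F) :
    homogeneousMatrix γ g c ∈ component F γ g := by
  rw [mem_component]
  intro i j h
  by_contra hne
  exact h (if_neg hne)

/-- Over an infinite field, identities vanish at generic matrices. -/
theorem genericEval_eq_zero [Infinite F] {f : FreeAlgebra F (Letter G)}
    (hf : f ∈ identities (algebra F γ)) : genericEval F γ f = 0 := by
  ext1 i j
  -- Specializing the indeterminates at a point `p` gives a graded homomorphism to matrices over
  -- `F`, at which `f` vanishes; over an infinite field this makes each entry the zero polynomial.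
  refine MvPolynomial.funext fun p => ?_
  have hφ := isHom_substitution (algebra F γ) one_mem_component
    (a := fun k g => homogeneousMatrix γ g fun a => p (k, g, a))
    fun k g => homogeneousMatrix_mem g _
  have e : (MvPolynomial.aeval p).mapMatrix.comp (genericEval F γ) =
      substitution (algebra F γ) fun k g => homogeneousMatrix γ g fun a => p (k, g, a) := by
    have hm : ∀ k g, (homogeneousMatrix γ g fun a => MvPolynomial.X (R := F) (k, g, a)).map
        (MvPolynomial.aeval p) = homogeneousMatrix γ g fun a => p (k, g, a) := by
      intro k g
      ext i j
      simp only [homogeneousMatrix, Matrix.map_apply, Matrix.of_apply]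
      split_ifs <;> simp
    refine FreeAlgebra.hom_ext (funext fun l => ?_)
    cases l with
    | x k g =>
      simp only [genericEval, Function.comp_apply, AlgHom.comp_apply, FreeAlgebra.lift_ι_apply,
        AlgHom.mapMatrix_apply, substitution_X]
      exact hm k g
    | xs k g =>
      simp only [genericEval, Function.comp_apply, AlgHom.comp_apply, FreeAlgebra.lift_ι_apply,
        AlgHom.mapMatrix_apply, substitution_Xs]
      exact congrArg Matrix.transpose (hm k g)
  have := congrFun (congrFun (hf _ hφ) i) j
  rw [← e] at this
  simpa [MvPolynomial.aeval_def, MvPolynomial.eval₂_eq_eval_map] using this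

end Generic

/-! ### Reduction of an identity to zero modulo the generators. -/

theorem identities_le_tIdealSpan [Infinite F] (hn : 1 ≤ n) (hγ : Function.Injective γ)
    {f : FreeAlgebra F (Letter G)} (hf : f ∈ identities (algebra F γ)) :
    f ∈ tIdealSpan (generators F γ) := by
  classical
  obtain ⟨c, rfl⟩ := (Finsupp.mem_span_range_iff_exists_finsupp (R := F)).1
    (show f ∈ Submodule.span F (Set.range (monomial F)) by
      rw [span_range_monomial]; exact Submodule.mem_top)
  change Finsupp.linearCombination F (monomial F) c ∈ _ at hf
  change Finsupp.linearCombination F (monomial F) c ∈ _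
  induction hN : c.support.card using Nat.strong_induction_on generalizing c with
  | _ N ih =>
  subst hN
  rcases eq_or_ne c 0 with rfl | hc
  · simp
  obtain ⟨w, hw⟩ := Finsupp.support_nonempty_iff.2 hc
  -- it suffices to remove `w` by means of an element of the ideal
  have key : ∀ d : List (Letter G) →₀ F, d.support ⊂ c.support →
      Finsupp.linearCombination F (monomial F) (c - d) ∈ tIdealSpan (generators F γ) →
      Finsupp.linearCombination F (monomial F) c ∈ tIdealSpan (generators F γ) := by
    intro d hd hcd
    -- The combination given by `d` is again an identity, because the ideal consists of identities.
    have hd' := ih _ (Finset.card_lt_card hd) d (by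
      have h := TwoSidedIdeal.sub_mem _ (mem_identitiesIdeal.2 hf)
        (mem_identitiesIdeal.2 (tIdealSpan_le_identities hγ hcd))
      rw [← map_sub, sub_sub_cancel] at h
      exact mem_identitiesIdeal.1 h) rfl
    have h := TwoSidedIdeal.add_mem _ hd' hcd
    rwa [← map_add, add_sub_cancel] at h
  have smul_mem : ∀ (r : F) {a : FreeAlgebra F (Letter G)}, a ∈ tIdealSpan (generators F γ) →
      r • a ∈ tIdealSpan (generators F γ) := fun r a ha => by
    rw [Algebra.smul_def]
    exact TwoSidedIdeal.mul_mem_left _ _ _ ha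
  by_cases hs : ∀ i, ¬ Stays (Set.range γ) (γ i) (w.map Letter.deg)
  · refine key (c.erase w) ?_ ?_
    · rw [Finsupp.support_erase]
      exact Finset.erase_ssubset hw
    · rw [← Finsupp.single_add_erase w c, Finsupp.erase_add, Finsupp.erase_single, zero_add,
        Finsupp.erase_idem, add_sub_cancel_right, Finsupp.linearCombination_single]
      exact smul_mem _ (monomial_mem_tIdealSpan hn hs)
  · push Not at hs
    obtain ⟨i, hi⟩ := hs
    have hend : ∃ j, γ i * wordDeg w = γ j := by
      have : ∀ (s : List (Letter G)) (a : G), Stays (Set.range γ) a (s.map Letter.deg) →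
          ∃ j, a * wordDeg s = γ j := by
        intro s
        induction s with
        | nil => rintro a ⟨j, rfl⟩; exact ⟨j, by simp⟩
        | cons l s ih =>
          rintro a h
          obtain ⟨j, hj⟩ := ih _ h.2
          exact ⟨j, by rw [← hj, wordDeg_cons, mul_assoc]⟩
      exact this w _ hi
    obtain ⟨j, hj⟩ := hend
    have h0 := congrArg (MvPolynomial.coeff (Multiset.toFinsupp (edges (γ i) w)))
      (congrFun (congrFun (genericEval_eq_zero hf) i) j)
    rw [Finsupp.linearCombination_apply, Finsupp.sum, map_sum, Matrix.sum_apply,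
      MvPolynomial.coeff_sum, ← Finset.add_sum_erase _ _ hw] at h0
    -- Were `w` the only word with these edges, the coefficient of its edge monomial in the entry
    -- `(i,j)` would be `c w ≠ 0`.
    obtain ⟨w', hw', hne⟩ : ∃ w' ∈ c.support.erase w, edges (γ i) w = edges (γ i) w' := by
      by_contra! hne
      rw [Finset.sum_eq_zero, map_smul, Matrix.smul_apply, genericEval_monomial hγ,
        if_pos ⟨hi, hj⟩] at h0
      · refine Finsupp.mem_support_iff.1 hw ?_
        simpa using h0
      · intro w' hw'
        rw [map_smul, Matrix.smul_apply, genericEval_monomial hγ, MvPolynomial.coeff_smul]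
        split_ifs
        · rw [MvPolynomial.coeff_monomial, if_neg, smul_zero]
          exact fun h => hne w' hw' (Multiset.toFinsupp.injective h).symm
        · simp
    -- The coefficient of `w` is moved to `w'`, which already lies in the support, so the support
    -- loses `w` and gains nothing.
    refine key (c - (Finsupp.single w (c w) - Finsupp.single w' (c w))) ?_ ?_
    · refine (Finset.ssubset_iff_of_subset ?_).2 ⟨w, hw, ?_⟩
      · intro v hv
        by_contra hvc
        have h₁ : v ≠ w := fun h => hvc (h ▸ hw)
        have h₂ : v ≠ w' := fun h => hvc (h ▸ Finset.mem_of_mem_erase hw')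
        refine Finsupp.mem_support_iff.1 hv ?_
        simp [h₁.symm, h₂.symm, Finsupp.notMem_support_iff.1 hvc]
      · have h₂ : w' ≠ w := Finset.ne_of_mem_erase hw'
        simp [h₂]
    · rw [sub_sub_cancel, map_sub, Finsupp.linearCombination_single,
        Finsupp.linearCombination_single, ← smul_sub]
      refine smul_mem _ ((isTIdeal_tIdealSpan _).sub_mem_of_edges_eq (k := 1) ?_ hne)
      exact subset_tIdealSpan (Or.inl (Or.inl (Or.inr rfl)))

end MatrixGStar

theorem mainTheorem1 {F : Type u} [Field F] [Infinite F] {G : Type v} [Group G]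
    (n : ℕ) (hn : 1 ≤ n) (γ : Fin n → G) (hγ : Function.Injective γ) :
    FreeGStar.identities (MatrixGStar.algebra F γ) =
      (FreeGStar.tIdealSpan (MatrixGStar.generators F γ) : Set (FreeAlgebra F (Letter G))) :=
  Set.Subset.antisymm (fun _ hf => MatrixGStar.identities_le_tIdealSpan hn hγ hf)
    fun _ hf => MatrixGStar.tIdealSpan_le_identities hγ hf
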